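/- **Theorem 1.6 (Event-level lower bound).** Let $\mathcal U$ be a universe. A turnstile stream of length $T$ is a vector $x\in(\{+,-\}\times\mathcal U\cup\{\bot\})^T$ of insertions $+u$, deletions $-u$ and no-ops $\bot$. For $u\in\mathcal U$ and $t\in[T]$ let $f_u(x)[t]=1$ if $x[1],\dots,x[t]$ contain strictly more insertions than deletions of $u$, and $f_u(x)[t]=0$ otherwise; let $\mathsf{CountDistinct}(x)[t]=\sum_{u\in\mathcal U}f_u(x)[t]$. The maximum flippancy of $x$ is $w_x=\max_{u}|\{j\in[T-1]: f_u(x)[j]\ne f_u(x)[j+1]\}|$. A mechanism $\mathcal M$ maps every stream $x$ of length $T$ to a random vector $\mathcal M(x)\in\mathbb R^T$. It is $(\varepsilon,\delta)$-event-level-DP if $\Pr[\mathcal M(x)\in S]\le e^{\varepsilon}\Pr[\mathcal M(x')\in S]+\delta$ for all measurable $S\subseteq\mathbb R^T$ and all $x,x'$ such that one of them is obtained from the other by replacing one entry with $\bot$. It is $\alpha$-accurate on a set of streams if $\Pr[\|\mathsf{CountDistinct}(x)-\mathcal M(x)\|_\infty\le\alpha]\ge 0.99$ for every $x$ in that set.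 There are absolute constants $c,\eta>0$ and $N\in\mathbb N$ such that the following holds for every $T\ge N$, every universe $\mathcal U$ with at least $T$ elements, all $\varepsilon\in(0,1]$ and $0\le\delta\le\eta\,\varepsilon/T$ (in particular, when $\delta=o(\varepsilon/T)$ and $T$ is sufficiently large), and every $(\varepsilon,\delta)$-event-level-DP mechanism $\mathcal M$ for streams of length $T$ over $\mathcal U$. If $N\le w\le T$ and $\mathcal M$ is $\alpha$-accurate on the streams of length $T$ with maximum flippancy at most $w$, then $$\alpha\ \ge\ c\cdot\min\left(\frac{\sqrt w}{\varepsilon},\ \frac{T^{1/4}}{\varepsilon^{3/4}},\ T\right).$$ In particular, if $\mathcal M$ is $\alpha$-accurate on all turnstile streams of length $T$, then $\alpha\ge c\,T^{1/4}$. -/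

import Mathlib

namespace TurnstileDP

/-- A stream entry over the universe `U`: an insertion `+u`, a deletion `-u`, or a no-op `⊥`. -/
inductive Entry (U : Type*) where
  | ins (u : U) : Entry U
  | del (u : U) : Entry U
  | noop : Entry U

/-- Turnstile streams of length `T`. Time steps are indexed by `Fin T`, that is, by `0, …, T - 1`;
the prefix up to and including step `t` consists of the entries at the steps `s ≤ t`. -/
abbrev Stream (U : Type*) (T : ℕ) := Fin T → Entry U

section Counting

variable {U : Type*} {T : ℕ}

open scoped Classical in
/-- The number of occurrences of the entry `e` in the prefix of `x` up to and including step `t`. -/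
noncomputable def occurrences (x : Stream U T) (e : Entry U) (t : Fin T) : ℕ :=
  (Finset.univ.filter fun s : Fin T => s ≤ t ∧ x s = e).card

open scoped Classical in
/-- The existence vector of `u` in `x`: it is `1` at step `t` if there are strictly more insertions
than deletions of `u` up to and including step `t`, and `0` otherwise. -/
noncomputable def existence (u : U) (x : Stream U T) (t : Fin T) : ℕ :=
  if occurrences x (Entry.del u) t < occurrences x (Entry.ins u) t then 1 else 0

/-- Only finitely many elements exist at any step, whatever the size of the universe. -/
theorem finite_support_existence (x : Stream U T) (t : Fin T) :
    (Function.support fun u : U => existence u x t).Finite := by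
  classical
  refine (Set.finite_range x).preimage (f := Entry.ins)
    (fun a _ b _ h => by simpa using h) |>.subset ?_
  intro u hu
  have h : occurrences x (Entry.del u) t < occurrences x (Entry.ins u) t := by
    by_contra hc
    exact hu (by simp [existence, hc])
  obtain ⟨s, hs⟩ := Finset.card_pos.mp (lt_of_le_of_lt (Nat.zero_le _) h)
  exact ⟨s, (Finset.mem_filter.mp hs).2.2⟩

/-- `CountDistinct(x)[t] = ∑_u f_u(x)[t]`; the sum is finite by `finite_support_existence`. -/
noncomputable def countDistinct (x : Stream U T) (t : Fin T) : ℕ :=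
  ∑ᶠ u : U, existence u x t

open scoped Classical in
/-- The flippancy of `u` in `x`: the number of pairs of adjacent entries of the existence vector
with different values. -/
noncomputable def flippancy (u : U) (x : Stream U T) : ℕ :=
  (Finset.univ.filter fun p : Fin T × Fin T =>
    (p.1 : ℕ) + 1 = (p.2 : ℕ) ∧ existence u x p.1 ≠ existence u x p.2).card

theorem bddAbove_flippancy (x : Stream U T) :
    BddAbove (Set.range fun u : U => flippancy u x) := by
  classical
  refine ⟨(Finset.univ : Finset (Fin T × Fin T)).card, ?_⟩
  rintro _ ⟨u, rfl⟩
  exact Finset.card_le_card (Finset.filter_subset _ _)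

/-- The maximum flippancy `w_x = max_u flip(u, x)`; the set of flippancies is bounded by
`bddAbove_flippancy`, so the supremum in `ℕ` is a maximum when `U` is nonempty. -/
noncomputable def maxFlippancy (x : Stream U T) : ℕ :=
  ⨆ u : U, flippancy u x

/-- `x'` is obtained from `x` by replacing one entry with `⊥`, or vice versa. -/
def EventNeighbors (x x' : Stream U T) : Prop :=
  ∃ t : Fin T, x' = Function.update x t Entry.noop ∨ x = Function.update x' t Entry.noop

end Counting

/-- A mechanism: for each input stream of length `T`, the law of its random vector of `T` real
answers. The answer at step `t` may depend on the whole stream (an offline mechanism), so in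
particular every mechanism in the continual release model is included. -/
abbrev Mechanism (U : Type*) (T : ℕ) :=
  Stream U T → MeasureTheory.ProbabilityMeasure (Fin T → ℝ)

section Guarantees

variable {U : Type*} {T : ℕ}

/-- `(ε, δ)`-event-level differential privacy. -/
def EventLevelDP (M : Mechanism U T) (ε δ : ℝ) : Prop :=
  ∀ x x' : Stream U T, EventNeighbors x x' →
    ∀ S : Set (Fin T → ℝ), MeasurableSet S →
      (M x : MeasureTheory.Measure (Fin T → ℝ)).real S ≤
        Real.exp ε * (M x' : MeasureTheory.Measure (Fin T → ℝ)).real S + δ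

/-- The error `‖CountDistinct(x) - a‖_∞` of an answer vector `a`
(the norm of `Fin T → ℝ` is the sup norm). -/
noncomputable def err (x : Stream U T) (a : Fin T → ℝ) : ℝ :=
  ‖(fun t => (countDistinct x t : ℝ)) - a‖

/-- `M` is `α`-accurate for `CountDistinct` on the streams in `X`: on each of them its answer vector
has error at most `α` with probability at least `0.99`. -/
def AccurateOn (M : Mechanism U T) (α : ℝ) (X : Set (Stream U T)) : Prop :=
  ∀ x ∈ X, (99 / 100 : ℝ) ≤
    (M x : MeasureTheory.Measure (Fin T → ℝ)).real {a | err x a ≤ α}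

end Guarantees

end TurnstileDP

namespace TurnstileDP

/-! A reconstruction attack. Bits `y ∈ {0,1}^n` are stored by inserting `g` distinct elements for
every bit equal to 1. For each row `j` of a symmetric Hadamard matrix `H`, the elements of the
coordinates with `H j i = -1` are inserted, the count is read, and they are deleted again.
Multiplicities make existence an OR, so the count is `g` times the size of `y ∨ q j`, which reveals
the inner product of `y` with `(1 + H j) / 2`; together with the all-ones row this gives `H y` up to
`3 α / g` per coordinate (`countDistinct_queryStream`). Inverting `H` and rounding leaves at most
`36 (α / g)²` wrong bits (`hadamard_decode`).

Flipping one bit changes at most `g` entries, so for `g ε ≤ 1` group privacy costs only constants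
(`EventLevelDP.group`), and then a constant fraction of the bits must be unrecoverable
(`not_private_of_reconstruction`). Hence `α ≥ g √n / 14` (`mul_sqrt_le_of_accurateOn`), provided
that `n g (2n + 1) ≤ T` and `2n + 1 ≤ w`. Taking `g ≈ min(1/ε, T)` and the largest admissible power
of two for `n` yields the three terms of the minimum (`exists_parameters`). -/

/-! ### Hadamard matrices -/

/-- Sylvester's construction: symmetric Hadamard matrices whose order is a power of two. -/
theorem exists_symm_hadamard (m : ℕ) : ∃ H : Fin (2 ^ m) → Fin (2 ^ m) → ℝ,
    (∀ i j, H i j = 1 ∨ H i j = -1) ∧ (∀ i j, H i j = H j i) ∧ (∃ j₀, ∀ i, H j₀ i = 1) ∧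
      ∀ i i', ∑ j, H j i * H j i' = if i = i' then (2 : ℝ) ^ m else 0 := by
  induction m with
  | zero => exact ⟨fun _ _ => 1, by simp, by simp, ⟨0, by simp⟩, by simp⟩
  | succ m ih =>
    obtain ⟨H, h1, hs, ⟨j₀, h0⟩, ho⟩ := ih
    let e : Fin (2 ^ (m + 1)) ≃ Fin 2 × Fin (2 ^ m) :=
      (finCongr (pow_succ' 2 m)).trans finProdFinEquiv.symm
    -- `s` is the Hadamard matrix of order 2. The new matrix is the Kronecker product of `s` and
    -- `H`, so every required property follows factor by factor.
    let s : Fin 2 → Fin 2 → ℝ := fun p q => if p = 1 ∧ q = 1 then -1 else 1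
    have s1 : ∀ p q, s p q = 1 ∨ s p q = -1 := by
      intro p q; simp only [s]; split_ifs <;> simp
    have s2 : ∀ p q, s p q * s p q = 1 := by
      intro p q; rcases s1 p q with h | h <;> simp [h]
    have ss : ∀ p q, s p q = s q p := by intro p q; simp only [s, and_comm]
    refine ⟨fun a b => s (e a).1 (e b).1 * H (e a).2 (e b).2, ?_, ?_, ⟨e.symm (0, j₀), ?_⟩, ?_⟩
    · intro i j
      rcases s1 (e i).1 (e j).1 with h | h <;> rcases h1 (e i).2 (e j).2 with h' | h' <;>
        simp [h, h']
    · intro i j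
      change s _ _ * H _ _ = s _ _ * H _ _
      rw [ss, hs]
    · intro i
      simp [s, h0]
    · intro i i'
      rw [← e.symm.sum_comp]
      have hm : ∀ p k, s p (e i).1 * H k (e i).2 * (s p (e i').1 * H k (e i').2) =
          s p (e i).1 * s p (e i').1 * (H k (e i).2 * H k (e i').2) := fun p k =>
        mul_mul_mul_comm _ _ _ _
      simp only [Equiv.apply_symm_apply, Fintype.sum_prod_type, hm, ← Finset.mul_sum, ho]
      have hi : i = i' ↔ (e i).1 = (e i').1 ∧ (e i).2 = (e i').2 := by
        rw [← Prod.ext_iff, e.apply_eq_iff_eq]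
      rw [Fin.sum_univ_two, ← add_mul]
      by_cases h2 : (e i).2 = (e i').2
      · by_cases h3 : (e i).1 = (e i').1
        · rw [if_pos h2, if_pos (hi.2 ⟨h3, h2⟩), h3, s2, s2, one_add_one_eq_two, ← pow_succ']
        · rw [if_neg (fun h => h3 (hi.1 h).1)]
          generalize (e i).1 = p at *
          generalize (e i').1 = p' at *
          fin_cases p <;> fin_cases p' <;> simp [s] at h3 ⊢
      · rw [if_neg h2, if_neg (fun h => h2 (hi.1 h).2), mul_zero]

/-! ### The query stream: flippancy and counts -/

variable {U : Type*} {T : ℕ}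

theorem existence_eq_of_entry_ne (u : U) (x : Stream U T) {p p' : Fin T}
    (hp : (p : ℕ) + 1 = p') (hi : x p' ≠ Entry.ins u) (hd : x p' ≠ Entry.del u) :
    existence u x p = existence u x p' := by
  have key : ∀ e : Entry U, x p' ≠ e → occurrences x e p = occurrences x e p' := by
    intro e he
    unfold occurrences
    congr 1
    ext s
    simp only [Finset.mem_filter, Finset.mem_univ, true_and]
    refine and_congr_left fun hs => ?_
    have : s ≠ p' := by rintro rfl; exact he hs
    have : (s : ℕ) ≠ p' := fun h => this (Fin.ext h)
    simp only [Fin.le_def]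
    omega
  simp only [existence, key _ hi, key _ hd]

-- Existence can change only at a step that touches `u`, so the later step of each flip injects the
-- flips into the entries for `u`.
open scoped Classical in
theorem flippancy_le_card_entries (u : U) (x : Stream U T) :
    flippancy u x ≤
      (Finset.univ.filter fun s : Fin T => x s = Entry.ins u ∨ x s = Entry.del u).card := by
  unfold flippancy
  refine Finset.card_le_card_of_injOn Prod.snd ?_ ?_
  · intro p hp
    simp only [Finset.coe_filter, Finset.mem_univ, true_and, Set.mem_ofPred_eq] at hp ⊢
    by_contra! h
    exact hp.2 (existence_eq_of_entry_ne u x hp.1 h.1 h.2)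
  · rintro ⟨p, p'⟩ hp ⟨r, r'⟩ hr h
    simp only [Finset.coe_filter, Finset.mem_univ, true_and, Set.mem_ofPred_eq] at hp hr h
    subst h
    simp only [Prod.mk.injEq, and_true]
    exact Fin.ext (by omega)

/-- The operation performed on `u` in block `b`: block `0` inserts the elements selected by `y`,
block `2 j + 1` inserts the elements selected by `q j`, and block `2 j + 2` deletes them again. -/
def blockEntry (y : ℕ → Bool) (q : ℕ → ℕ → Bool) (b i : ℕ) (u : U) : Entry U :=
  if b = 0 then if y i then Entry.ins u else Entry.noop
  else if b % 2 = 1 then if q (b / 2) i then Entry.ins u else Entry.noop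
  else if q (b / 2 - 1) i then Entry.del u else Entry.noop

theorem blockEntry_cases (y : ℕ → Bool) (q : ℕ → ℕ → Bool) (b i : ℕ) (u : U) :
    blockEntry y q b i u = Entry.ins u ∨ blockEntry y q b i u = Entry.del u ∨
      blockEntry y q b i u = Entry.noop := by
  unfold blockEntry
  split_ifs <;> simp

-- Blocks `0, …, 2 j` contain only completed insert-delete pairs besides block `0`, so the surplus
-- of insertions is the stored bit.
open scoped Classical in
theorem count_blockEntry_odd (y : ℕ → Bool) (q : ℕ → ℕ → Bool) (i : ℕ) (u : U) (j : ℕ) :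
    Nat.count (fun b => blockEntry y q b i u = Entry.ins u) (2 * j + 1) =
      Nat.count (fun b => blockEntry y q b i u = Entry.del u) (2 * j + 1) + (y i).toNat := by
  induction j with
  | zero =>
    rw [Nat.count_succ, Nat.count_succ]
    cases h : y i <;> simp [blockEntry, h]
  | succ j ih =>
    rw [show 2 * (j + 1) + 1 = 2 * j + 1 + 1 + 1 by ring, Nat.count_succ _ (2 * j + 1 + 1),
      Nat.count_succ _ (2 * j + 1), ih, Nat.count_succ _ (2 * j + 1 + 1),
      Nat.count_succ _ (2 * j + 1)]
    generalize Nat.count (fun b => blockEntry y q b i u = Entry.del u) (2 * j + 1) = k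
    have h1 : (2 * j + 1) % 2 = 1 := by omega
    have h2 : (2 * j + 1 + 1) % 2 ≠ 1 := by omega
    have h3 : (2 * j + 1 + 1) / 2 - 1 = j := by omega
    have h4 : (2 * j + 1) / 2 = j := by omega
    simp only [blockEntry, h1, h2, h3, h4]
    cases h : q j i
    · simp
    · simp
      omega

-- After block `2 j + 1` the surplus is the sum of the two bits, and it is positive exactly when one
-- of them is set.
open scoped Classical in
theorem count_blockEntry_lt_iff (y : ℕ → Bool) (q : ℕ → ℕ → Bool) (i : ℕ) (u : U) (j : ℕ) :
    Nat.count (fun b => blockEntry y q b i u = Entry.del u) (2 * j + 2) <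
      Nat.count (fun b => blockEntry y q b i u = Entry.ins u) (2 * j + 2) ↔
        (y i || q j i) = true := by
  rw [Nat.count_succ _ (2 * j + 1), Nat.count_succ _ (2 * j + 1), count_blockEntry_odd]
  generalize Nat.count (fun b => blockEntry y q b i u = Entry.del u) (2 * j + 1) = k
  have h1 : (2 * j + 1) % 2 = 1 := by omega
  have h4 : (2 * j + 1) / 2 = j := by omega
  simp only [blockEntry, h1, h4]
  cases h : q j i <;> cases h' : y i <;> simp

/-- The stream made of `2 n + 1` blocks of length `n * g`, in which coordinate `i < n` is
represented by the `g` elements `v (i * g), …, v (i * g + g - 1)`. -/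
def queryStream (T n g : ℕ) (v : ℕ → U) (y : ℕ → Bool) (q : ℕ → ℕ → Bool) : Stream U T :=
  fun s => if (s : ℕ) < n * g * (2 * n + 1) then
    blockEntry y q (s / (n * g)) (s % (n * g) / g) (v (s % (n * g))) else Entry.noop

section QueryStream

variable {n g : ℕ} {v : ℕ → U} {y : ℕ → Bool} {q : ℕ → ℕ → Bool}

theorem queryStream_entry (s : Fin T) (u : U)
    (h : queryStream T n g v y q s = Entry.ins u ∨ queryStream T n g v y q s = Entry.del u) :
    (s : ℕ) < n * g * (2 * n + 1) ∧ v (s % (n * g)) = u := by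
  unfold queryStream at h
  split_ifs at h with hs
  · refine ⟨hs, ?_⟩
    rcases blockEntry_cases y q (s / (n * g)) (s % (n * g) / g) (v (s % (n * g))) with h' | h' | h'
    · simpa [h'] using h
    · simpa [h'] using h
    · simp [h'] at h
  · simp at h

theorem mod_eq_of_entry (hng : 0 < n * g) (hT : n * g * (2 * n + 1) ≤ T)
    (hv : Set.InjOn v (Set.Iio T)) {s r : ℕ} (hr : r < n * g) (h : v (s % (n * g)) = v r) :
    s % (n * g) = r := by
  have hle : n * g ≤ T := le_trans (Nat.le_mul_of_pos_right _ (by omega)) hT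
  exact hv (lt_of_lt_of_le (Nat.mod_lt _ hng) hle) (lt_of_lt_of_le hr hle) h

/-- Each of the `2 n + 1` blocks touches a given element at most once. -/
theorem maxFlippancy_queryStream_le (hng : 0 < n * g) (hT : n * g * (2 * n + 1) ≤ T)
    (hv : Set.InjOn v (Set.Iio T)) :
    maxFlippancy (queryStream T n g v y q) ≤ 2 * n + 1 := by
  classical
  refine ciSup_le' fun u => (flippancy_le_card_entries u _).trans ?_
  rw [← Finset.card_range (2 * n + 1)]
  refine Finset.card_le_card_of_injOn (fun s : Fin T => (s : ℕ) / (n * g)) ?_ ?_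
  · intro s hs
    simp only [Finset.coe_filter, Finset.mem_univ, true_and, Set.mem_ofPred_eq] at hs
    simp only [Finset.coe_range, Set.mem_Iio]
    exact Nat.div_lt_of_lt_mul (queryStream_entry s u hs).1
  · intro s hs s' hs' h
    simp only [Finset.coe_filter, Finset.mem_univ, true_and, Set.mem_ofPred_eq] at hs hs' h
    have h1 := (queryStream_entry s u hs).2
    have h2 := (queryStream_entry s' u hs').2
    have h3 := mod_eq_of_entry hng hT hv (Nat.mod_lt s' hng) (h1.trans h2.symm)
    apply Fin.ext
    rw [← Nat.div_add_mod s (n * g), ← Nat.div_add_mod s' (n * g), h, h3]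

-- Every block has exactly one slot for `v r`, at offset `r`; thus `s ↦ s / (n * g)` matches
-- occurrences with blocks. The hypothesis `ht` says that `t` is the last step of block `B - 1`.
open scoped Classical in
theorem occurrences_queryStream (hT : n * g * (2 * n + 1) ≤ T)
    (hv : Set.InjOn v (Set.Iio T)) {r : ℕ} (hr : r < n * g) (t : Fin T) {B : ℕ}
    (hB : B ≤ 2 * n + 1) (ht : n * g * B = t + 1) (e : Entry U)
    (he : e = Entry.ins (v r) ∨ e = Entry.del (v r)) :
    occurrences (queryStream T n g v y q) e t =
      Nat.count (fun b => blockEntry y q b (r / g) (v r) = e) B := by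
  have hng : 0 < n * g := by omega
  rw [Nat.count_eq_card_filter_range, occurrences]
  refine Finset.card_bij (fun s _ => (s : ℕ) / (n * g)) ?_ ?_ ?_
  · intro s hs
    simp only [Finset.mem_filter, Finset.mem_univ, true_and, Finset.mem_range] at hs ⊢
    have h1 := queryStream_entry (n := n) (g := g) (v := v) (y := y) (q := q) s (v r)
      (by rcases he with rfl | rfl <;> simp [hs.2])
    have h2 := mod_eq_of_entry hng hT hv hr h1.2
    refine ⟨Nat.div_lt_of_lt_mul ?_, ?_⟩
    · have := hs.1
      rw [Fin.le_def] at this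
      omega
    · have h3 := hs.2
      rw [queryStream, if_pos h1.1, h2] at h3
      exact h3
  · intro s hs s' hs' h
    simp only [Finset.mem_filter, Finset.mem_univ, true_and] at hs hs'
    have h1 := queryStream_entry (n := n) (g := g) (v := v) (y := y) (q := q) s (v r)
      (by rcases he with rfl | rfl <;> simp [hs.2])
    have h1' := queryStream_entry (n := n) (g := g) (v := v) (y := y) (q := q) s' (v r)
      (by rcases he with rfl | rfl <;> simp [hs'.2])
    have h2 := mod_eq_of_entry hng hT hv hr h1.2
    have h2' := mod_eq_of_entry hng hT hv hr h1'.2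
    apply Fin.ext
    rw [← Nat.div_add_mod s (n * g), ← Nat.div_add_mod s' (n * g), h, h2, h2']
  · intro b hb
    simp only [Finset.mem_filter, Finset.mem_range] at hb
    have hlt : n * g * b + r < n * g * B := by
      calc n * g * b + r < n * g * b + n * g := by omega
        _ = n * g * (b + 1) := by ring
        _ ≤ n * g * B := Nat.mul_le_mul_left _ hb.1
    have hlt' : n * g * b + r < n * g * (2 * n + 1) :=
      lt_of_lt_of_le hlt (Nat.mul_le_mul_left _ hB)
    have hdiv : (n * g * b + r) / (n * g) = b := by
      rw [Nat.mul_add_div hng, Nat.div_eq_of_lt hr, add_zero]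
    have hmod : (n * g * b + r) % (n * g) = r := by
      rw [Nat.mul_add_mod, Nat.mod_eq_of_lt hr]
    refine ⟨⟨n * g * b + r, by omega⟩, ?_, hdiv⟩
    simp only [Finset.mem_filter, Finset.mem_univ, true_and, Fin.le_def]
    refine ⟨by omega, ?_⟩
    rw [queryStream, if_pos hlt']
    simp only [hdiv, hmod]
    exact hb.2

theorem sum_range_mul_div {M : Type*} [AddCommMonoid M] (n : ℕ) {g : ℕ} (hg : 0 < g) (f : ℕ → M) :
    ∑ r ∈ Finset.range (n * g), f (r / g) = g • ∑ i ∈ Finset.range n, f i := by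
  induction n with
  | zero => simp
  | succ n ih =>
    rw [add_mul, one_mul, Finset.sum_range_add, ih, Finset.sum_range_succ, smul_add]
    congr 1
    rw [Finset.sum_congr rfl (g := fun _ => f n), Finset.sum_const, Finset.card_range]
    intro r hr
    rw [mul_comm, Nat.mul_add_div hg, Nat.div_eq_of_lt (Finset.mem_range.1 hr), add_zero]

theorem countDistinct_queryStream (hg : 0 < g) (hT : n * g * (2 * n + 1) ≤ T)
    (hv : Set.InjOn v (Set.Iio T)) {j : ℕ} (hj : j < n) (t : Fin T)
    (ht : n * g * (2 * j + 2) = t + 1) :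
    countDistinct (queryStream T n g v y q) t =
      g * ∑ i ∈ Finset.range n, (y i || q j i).toNat := by
  classical
  have hng : 0 < n * g := Nat.mul_pos (by omega) hg
  have hle : n * g ≤ T := le_trans (Nat.le_mul_of_pos_right _ (by omega)) hT
  have hinj : Set.InjOn v (Finset.range (n * g)) := hv.mono fun r hr =>
    lt_of_lt_of_le (Finset.mem_range.1 hr) hle
  rw [countDistinct, finsum_eq_sum_of_support_subset (s := (Finset.range (n * g)).image v),
    Finset.sum_image hinj, ← smul_eq_mul g,
    ← sum_range_mul_div n hg fun i => (y i || q j i).toNat]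
  · refine Finset.sum_congr rfl fun r hr => ?_
    have hr := Finset.mem_range.1 hr
    rw [existence, occurrences_queryStream hT hv hr t (by omega) ht _ (Or.inl rfl),
      occurrences_queryStream hT hv hr t (by omega) ht _ (Or.inr rfl)]
    simp only [count_blockEntry_lt_iff]
    cases h : (y (r / g) || q j (r / g)) <;> simp
  · intro u hu
    simp only [Finset.coe_image, Set.mem_image, Finset.mem_coe, Finset.mem_range]
    have h : occurrences (queryStream T n g v y q) (Entry.del u) t <
        occurrences (queryStream T n g v y q) (Entry.ins u) t := by
      by_contra hc
      exact hu (by simp [existence, hc])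
    obtain ⟨s, hs⟩ := Finset.card_pos.mp (lt_of_le_of_lt (Nat.zero_le _) h)
    exact ⟨_, Nat.mod_lt _ hng, (queryStream_entry s u (Or.inl (Finset.mem_filter.mp hs).2.2)).2⟩

end QueryStream

/-! ### Group privacy, and reconstruction against privacy -/

open MeasureTheory


theorem EventNeighbors.symm {x x' : Stream U T} (h : EventNeighbors x x') :
    EventNeighbors x' x := by
  obtain ⟨t, h⟩ := h
  exact ⟨t, h.symm⟩

/-- Entries are erased one at a time, each costing a factor `exp ε` and an additive `δ`. Both
directions are needed, since a bit may flip either way. -/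
theorem EventLevelDP.group {M : Mechanism U T} {ε δ : ℝ} (hM : EventLevelDP M ε δ) (hε : 0 ≤ ε)
    (hδ : 0 ≤ δ) (x : Stream U T) {S : Set (Fin T → ℝ)} (hS : MeasurableSet S)
    (F : Finset (Fin T)) :
    (M x : Measure (Fin T → ℝ)).real S ≤ Real.exp (F.card * ε) *
        (M (fun s => if s ∈ F then Entry.noop else x s) : Measure (Fin T → ℝ)).real S +
          F.card * Real.exp (F.card * ε) * δ ∧
    (M (fun s => if s ∈ F then Entry.noop else x s) : Measure (Fin T → ℝ)).real S ≤
      Real.exp (F.card * ε) * (M x : Measure (Fin T → ℝ)).real S +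
          F.card * Real.exp (F.card * ε) * δ := by
  induction F using Finset.induction_on with
  | empty => simp
  | insert t F ht ih =>
    have hn : EventNeighbors (fun s => if s ∈ F then Entry.noop else x s)
        (fun s => if s ∈ insert t F then Entry.noop else x s) := by
      refine ⟨t, Or.inl (funext fun s => ?_)⟩
      by_cases hs : s = t
      · subst hs; simp
      · simp [hs]
    have h1 := hM _ _ hn S hS
    have h2 := hM _ _ hn.symm S hS
    rw [Finset.card_insert_of_notMem ht]
    push_cast
    rw [add_mul, one_mul, Real.exp_add]
    generalize (M (fun s => if s ∈ insert t F then Entry.noop else x s) :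
      Measure (Fin T → ℝ)).real S = c at *
    generalize (M (fun s => if s ∈ F then Entry.noop else x s) :
      Measure (Fin T → ℝ)).real S = b at *
    generalize (M x : Measure (Fin T → ℝ)).real S = a at *
    have hk : (0 : ℝ) ≤ F.card := Nat.cast_nonneg _
    have hA : 1 ≤ Real.exp (F.card * ε) := Real.one_le_exp (by positivity)
    have hE : 1 ≤ Real.exp ε := Real.one_le_exp hε
    generalize Real.exp (F.card * ε) = A at *
    generalize Real.exp ε = E at *
    generalize (F.card : ℝ) = k at *
    have e1 : 0 ≤ A * δ * (E - 1) := by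
      have := sub_nonneg.2 hE; positivity
    have e2 : 0 ≤ k * A * δ * (E - 1) := by
      have := sub_nonneg.2 hE; positivity
    have e3 : 0 ≤ δ * (A * E - 1) :=
      mul_nonneg hδ (sub_nonneg.2 (one_le_mul_of_one_le_of_one_le hA hE))
    constructor
    · have := mul_le_mul_of_nonneg_left h1 (zero_le_one.trans hA)
      linarith [ih.1]
    · have := mul_le_mul_of_nonneg_left ih.2 (zero_le_one.trans hE)
      linarith

/-- If the answers of a family of distributions indexed by bit vectors determine the bits up to a
small fraction, then the family cannot be insensitive to flipping one bit. -/
theorem not_private_of_reconstruction {Ω : Type*} [MeasurableSpace Ω] {n : ℕ} (hn : 0 < n)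
    (P : (Fin n → Bool) → Measure Ω) [∀ y, IsProbabilityMeasure (P y)]
    {K κ β γ : ℝ} (S : Fin n → Set Ω) (hS : ∀ i, MeasurableSet (S i))
    (G : (Fin n → Bool) → Set Ω) (hG : ∀ y, MeasurableSet (G y))
    (hGP : ∀ y, 1 - γ ≤ (P y).real (G y))
    (hwrong : ∀ y, ∀ ω ∈ G y,
      ∑ i, Set.indicator {ω | ¬ (ω ∈ S i ↔ y i = true)} (fun _ => (1 : ℝ)) ω ≤ β * n)
    (hβ : 0 ≤ β) (hK : 0 ≤ K)
    (hP : ∀ y i A, MeasurableSet A →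
      (P y).real A ≤ K * (P (Function.update y i (!y i))).real A + κ) :
    1 - κ ≤ (1 + K) * (β + γ) := by
  classical
  have hmeas : ∀ (y : Fin n → Bool) i, MeasurableSet {ω | ¬ (ω ∈ S i ↔ y i = true)} := by
    intro y i
    cases h : y i
    · convert hS i using 1
      ext
      simp
    · convert (hS i).compl using 1
      ext
      simp
  set w : (Fin n → Bool) → Fin n → ℝ := fun y i =>
    (P y).real {ω | ¬ (ω ∈ S i ↔ y i = true)} with hw
  -- The expected number of wrong bits is at most `β n` from the good event plus `n` times the
  -- probability, at most `γ`, of its complement.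
  have hsum : ∀ y, ∑ i, w y i ≤ (β + γ) * n := by
    intro y
    have h1 : ∑ i, w y i =
        ∫ ω, ∑ i, Set.indicator {ω | ¬ (ω ∈ S i ↔ y i = true)} (fun _ => (1 : ℝ)) ω ∂(P y) := by
      rw [integral_finsetSum]
      · refine Finset.sum_congr rfl fun i _ => ?_
        rw [integral_indicator_const _ (hmeas y i)]
        simp [hw]
      · intro i _
        exact (integrable_const _).indicator (hmeas y i)
    have h2 : ∫ ω, (β * n + Set.indicator (G y)ᶜ (fun _ => (n : ℝ)) ω) ∂(P y) =
        β * n + (P y).real (G y)ᶜ * n := by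
      rw [integral_add (integrable_const _) ((integrable_const _).indicator (hG y).compl),
        integral_indicator_const _ (hG y).compl]
      simp
    have h3 : ∑ i, w y i ≤ β * n + (P y).real (G y)ᶜ * n := by
      rw [h1, ← h2]
      refine integral_mono ?_ ?_ ?_
      · exact integrable_finsetSum _ fun i _ => (integrable_const _).indicator (hmeas y i)
      · exact (integrable_const _).add ((integrable_const _).indicator (hG y).compl)
      · intro ω
        by_cases h : ω ∈ G y
        · simpa [h] using hwrong y ω h
        · simp only [Set.mem_compl_iff, h, not_false_eq_true, Set.indicator_of_mem]
          calc _ ≤ ∑ _i : Fin n, (1 : ℝ) := Finset.sum_le_sum fun i _ =>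
                Set.indicator_le_self' (fun _ _ => zero_le_one) ω
            _ = n := by simp
            _ ≤ _ := le_add_of_nonneg_left (by positivity)
    have h4 : (P y).real (G y)ᶜ ≤ γ := by
      rw [probReal_compl_eq_one_sub (hG y)]
      linarith [hGP y]
    nlinarith [mul_le_mul_of_nonneg_right h4 (Nat.cast_nonneg (α := ℝ) n)]
  -- Decoding bit `i` correctly for `y` is decoding it wrongly for `y` with bit `i` flipped, and
  -- privacy compares the two probabilities.
  have hflip : ∀ y i, 1 - κ ≤ w y i + K * w (Function.update y i (!y i)) i := by
    intro y i
    have h := hP y i _ (hmeas y i).compl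
    rw [probReal_compl_eq_one_sub (hmeas y i)] at h
    have he : {ω | ¬ (ω ∈ S i ↔ y i = true)}ᶜ =
        {ω | ¬ (ω ∈ S i ↔ Function.update y i (!y i) i = true)} := by
      ext ω
      cases hy : y i <;> simp
    rw [he] at h
    simp only [hw]
    linarith
  -- Flipping bit `i` is an involution, so averaging over all `y` removes the flip.
  have hinv : ∀ i, ∑ y, w (Function.update y i (!y i)) i = ∑ y, w y i := by
    intro i
    have hi : Function.Involutive fun y : Fin n → Bool => Function.update y i (!y i) := by
      intro y
      simp
    exact Equiv.sum_comp hi.toPerm fun y => w y i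
  have htot : ∑ _y : Fin n → Bool, ∑ _i : Fin n, (1 - κ) ≤ (1 + K) * ∑ y, ∑ i, w y i := by
    calc _ ≤ ∑ y : Fin n → Bool, ∑ i, (w y i + K * w (Function.update y i (!y i)) i) :=
          Finset.sum_le_sum fun y _ => Finset.sum_le_sum fun i _ => hflip y i
      _ = _ := by
          rw [Finset.sum_comm, Finset.sum_comm (f := w)]
          simp only [Finset.sum_add_distrib, ← Finset.mul_sum, hinv]
          ring
  have hup : ∑ y, ∑ i, w y i ≤ ∑ _y : Fin n → Bool, (β + γ) * n :=
    Finset.sum_le_sum fun y _ => hsum y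
  simp only [Finset.sum_const, nsmul_eq_mul, Finset.card_univ, Fintype.card_fin] at htot hup
  have hc : (0 : ℝ) < Fintype.card (Fin n → Bool) := by exact_mod_cast Fintype.card_pos
  have hn' : (0 : ℝ) < n := by exact_mod_cast hn
  have h5 := htot.trans (mul_le_mul_of_nonneg_left hup (by linarith : 0 ≤ 1 + K))
  refine le_of_mul_le_mul_left ?_ (mul_pos hc hn')
  linarith

/-- Decoding noisy Hadamard measurements of a bit vector by inverting the matrix and rounding:
the number of wrong bits is controlled by the noise level. -/
theorem hadamard_decode {n : ℕ} (hn : 0 < n) (H : Fin n → Fin n → ℝ) (hs : ∀ i j, H i j = H j i)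
    (ho : ∀ i i', ∑ j, H j i * H j i' = if i = i' then (n : ℝ) else 0)
    (y : Fin n → Bool) (c : Fin n → ℝ) {τ : ℝ}
    (hc : ∀ j, |c j - ∑ i, H j i * ((y i).toNat : ℝ)| ≤ τ) :
    ∑ i, Set.indicator {c : Fin n → ℝ | ¬ (1 / 2 < (∑ j, H j i * c j) / n ↔ y i = true)}
      (fun _ => (1 : ℝ)) c ≤ 4 * τ ^ 2 := by
  have hn' : (0 : ℝ) < n := by exact_mod_cast hn
  set r : Fin n → ℝ := fun j => c j - ∑ i, H j i * ((y i).toNat : ℝ) with hr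
  set d : Fin n → ℝ := fun i => ∑ j, H j i * r j with hd
  -- Column orthogonality: the estimate is the true bit plus the transformed noise `d i / n`.
  have hest : ∀ i, (∑ j, H j i * c j) / n = (y i).toNat + d i / n := by
    intro i
    have : d i = ∑ j, H j i * c j - n * (y i).toNat := by
      simp only [hd, hr, mul_sub, Finset.sum_sub_distrib, Finset.mul_sum]
      rw [Finset.sum_comm (f := fun j k => H j i * (H j k * ((y k).toNat : ℝ)))]
      simp only [← mul_assoc, ← Finset.sum_mul, ho]
      simp
    rw [this]
    field_simp
    ring
  -- Parseval. It needs orthogonal rows, which symmetry derives from `ho`.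
  have hpars : ∑ i, d i ^ 2 = n * ∑ j, r j ^ 2 := by
    simp only [hd, sq, Finset.sum_mul_sum]
    rw [Finset.sum_comm]
    simp_rw [Finset.sum_comm (s := Finset.univ (α := Fin n)) (t := Finset.univ)
      (f := fun i k => H _ i * r _ * (H k i * r k))]
    have : ∀ j k, ∑ i, H j i * r j * (H k i * r k) = (if j = k then (n : ℝ) else 0) * (r j * r k) := by
      intro j k
      rw [← ho, Finset.sum_mul]
      refine Finset.sum_congr rfl fun i _ => ?_
      rw [hs i j, hs i k]
      ring
    simp only [this, ite_mul, zero_mul, Finset.sum_ite_eq, Finset.mem_univ, if_true,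
      Finset.mul_sum]
  -- A bit is rounded wrongly only if `|d i / n| ≥ 1 / 2`, and then its term is at least 1.
  calc _ ≤ ∑ i, 4 * (d i / n) ^ 2 := by
        refine Finset.sum_le_sum fun i _ => ?_
        by_cases h : 1 / 2 < (∑ j, H j i * c j) / n ↔ y i = true
        · rw [Set.indicator_of_notMem (by simpa using h)]
          positivity
        · rw [Set.indicator_of_mem (by exact h)]
          rw [hest i] at h
          cases hy : y i
          · simp [hy] at h
            nlinarith
          · simp [hy] at h
            nlinarith
    _ = 4 / n * ∑ j, r j ^ 2 := by
        simp only [div_pow, ← Finset.mul_sum, ← Finset.sum_div, hpars]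
        field_simp
    _ ≤ 4 / n * ∑ _j : Fin n, τ ^ 2 := by
        refine mul_le_mul_of_nonneg_left (Finset.sum_le_sum fun j _ => ?_) (by positivity)
        exact sq_le_sq.2 ((hc j).trans (le_abs_self _))
    _ = 4 * τ ^ 2 := by
        simp
        field_simp

/-! ### From accuracy to the bound for fixed parameters -/

/-- Erasing the entries that represent coordinate `i₀` of `y` changes at most `g` entries. -/
theorem queryStream_update_false {n g : ℕ} (hg : 0 < g) {v : ℕ → U} {y y' : ℕ → Bool}
    {q : ℕ → ℕ → Bool} {i₀ : ℕ} (hi₀ : i₀ < n) (hy : ∀ i < n, y' i = if i = i₀ then false else y i) :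
    ∃ F : Finset (Fin T), F.card ≤ g ∧ queryStream T n g v y' q =
      fun s => if s ∈ F then Entry.noop else queryStream T n g v y q s := by
  classical
  refine ⟨Finset.univ.filter fun s : Fin T => (s : ℕ) < n * g ∧ (s : ℕ) / g = i₀, ?_, ?_⟩
  · refine (Finset.card_le_card_of_injOn (t := Finset.range g) (fun s : Fin T => (s : ℕ) % g)
      ?_ ?_).trans_eq (Finset.card_range g)
    · intro s _
      simpa using Nat.mod_lt _ hg
    · intro s hs s' hs' h
      simp only [Finset.coe_filter, Finset.mem_univ, true_and, Set.mem_ofPred_eq] at hs hs' h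
      apply Fin.ext
      rw [← Nat.div_add_mod s g, ← Nat.div_add_mod s' g, h, hs.2, hs'.2]
  · funext s
    simp only [Finset.mem_filter, Finset.mem_univ, true_and]
    have hng : 0 < n * g := Nat.mul_pos (by omega) hg
    by_cases hs : (s : ℕ) < n * g
    · have h1 : (s : ℕ) < n * g * (2 * n + 1) :=
        lt_of_lt_of_le hs (Nat.le_mul_of_pos_right _ (by omega))
      have h2 : (s : ℕ) / g < n := Nat.div_lt_of_lt_mul (by rwa [mul_comm])
      simp only [queryStream, h1, if_true, Nat.div_eq_of_lt hs, Nat.mod_eq_of_lt hs, blockEntry,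
        hy _ h2, hs, true_and]
      split_ifs <;> simp_all
    -- Later blocks depend only on `q`, not on the stored bits.
    · have h0 : (s : ℕ) / (n * g) ≠ 0 := by
        rw [Ne, Nat.div_eq_zero_iff]
        omega
      simp [queryStream, hs, blockEntry, h0]

theorem err_measurableSet (x : Stream U T) (α : ℝ) : MeasurableSet {a | err x a ≤ α} := by
  unfold err
  exact (isClosed_le (by fun_prop) continuous_const).measurableSet

/-- The lower bound for a fixed choice of the number `n` of bits, of the number `g` of copies of each
bit, and of a symmetric Hadamard matrix of order `n`. -/
theorem mul_sqrt_le_of_accurateOn {M : Mechanism U T} {ε δ α : ℝ} {n g : ℕ} (hn : 0 < n) (H : Fin n → Fin n → ℝ)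
    (h1 : ∀ i j, H i j = 1 ∨ H i j = -1) (hs : ∀ i j, H i j = H j i) {j₀ : Fin n}
    (h0 : ∀ i, H j₀ i = 1) (ho : ∀ i i', ∑ j, H j i * H j i' = if i = i' then (n : ℝ) else 0)
    (hg : 0 < g) (hT : n * g * (2 * n + 1) ≤ T) (hU : (T : ℕ∞) ≤ ENat.card U) (hε : 0 ≤ ε)
    (hgε : g * ε ≤ 1) (hδ : 0 ≤ δ) (hgδ : g * δ ≤ 1 / 100) (hM : EventLevelDP M ε δ)
    (hα : AccurateOn M α {x | maxFlippancy x ≤ 2 * n + 1}) :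
    1 / 14 * (g * √(n : ℝ)) ≤ α := by
  classical
  by_contra! hlt
  have hng : 0 < n * g := Nat.mul_pos hn hg
  have hg' : (0 : ℝ) < g := by exact_mod_cast hg
  obtain ⟨v, hv⟩ : ∃ v : ℕ → U, Set.InjOn v (Set.Iio T) := by
    have hTpos : 0 < T := lt_of_lt_of_le (Nat.mul_pos hng (by omega)) hT
    have : Nonempty (Fin T ↪ U) := by
      rcases finite_or_infinite U with hU' | hU'
      · have := Fintype.ofFinite U
        refine Function.Embedding.nonempty_of_card_le ?_
        rw [ENat.card_eq_coe_fintype_card] at hU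
        simpa using hU
      · exact ⟨Fin.valEmbedding.trans (Infinite.natEmbedding U)⟩
    obtain ⟨f⟩ := this
    refine ⟨fun k => if h : k < T then f ⟨k, h⟩ else f ⟨0, hTpos⟩, fun a ha b hb h => ?_⟩
    simpa [Set.mem_Iio.1 ha, Set.mem_Iio.1 hb] using h
  have hnz : NeZero n := ⟨hn.ne'⟩
  let q : ℕ → ℕ → Bool := fun j i => decide (H (Fin.ofNat n j) (Fin.ofNat n i) = -1)
  have hqv : ∀ (j i : Fin n), q j i = decide (H j i = -1) := by
    intro j i
    simp only [q, Fin.ofNat_eq_cast, Fin.cast_val_eq_self]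
  let X : (Fin n → Bool) → Stream U T := fun y => queryStream T n g v (fun i => y (Fin.ofNat n i)) q
  have hXflip : ∀ y, maxFlippancy (X y) ≤ 2 * n + 1 := fun y => maxFlippancy_queryStream_le hng hT hv
  -- the step at the end of the block that inserts the `j`-th query
  have htlt : ∀ j : Fin n, n * g * (2 * j + 2) - 1 < T := by
    intro j
    have : n * g * (2 * j + 2) ≤ n * g * (2 * n + 1) := Nat.mul_le_mul_left _ (by omega)
    have : 0 < n * g * (2 * j + 2) := Nat.mul_pos hng (by omega)
    omega
  let t : Fin n → Fin T := fun j => ⟨_, htlt j⟩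
  have hcount : ∀ y j, (countDistinct (X y) (t j) : ℝ) =
      g * ∑ i : Fin n, ((y i || q j i).toNat : ℝ) := by
    intro y j
    have := countDistinct_queryStream (v := v) (y := fun i => y (Fin.ofNat n i)) (q := q) hg hT hv
      j.2 (t j) (by
        have : 0 < n * g * (2 * j + 2) := Nat.mul_pos hng (by omega)
        simp only [t]
        omega)
    rw [this, Finset.sum_range]
    simp only [Fin.ofNat_eq_cast, Fin.cast_val_eq_self]
    push_cast
    rfl
  -- the number of bits, and the noisy Hadamard measurements computed from the answers
  let b : (Fin T → ℝ) → Fin n → ℝ := fun a j => a (t j) / g - ∑ i : Fin n, ((q j i).toNat : ℝ)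
  let c : (Fin T → ℝ) → Fin n → ℝ := fun a j => 2 * b a j - b a j₀
  -- For bits, `y ∨ q = q + (1 - q) y`, and `1 - q = (1 + H) / 2` because `q` marks the entries
  -- `-1`.
  have hor : ∀ (y : Fin n → Bool) (j : Fin n), ∑ i : Fin n, ((y i || q j i).toNat : ℝ) =
      ∑ i : Fin n, ((q j i).toNat : ℝ) + ∑ i, (1 + H j i) / 2 * ((y i).toNat : ℝ) := by
    intro y j
    rw [← Finset.sum_add_distrib]
    refine Finset.sum_congr rfl fun i _ => ?_
    rw [hqv]
    rcases h1 j i with h | h <;> cases y i <;> simp [h] <;> norm_num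
  have hb : ∀ y a j, err (X y) a ≤ α →
      |b a j - ∑ i, (1 + H j i) / 2 * ((y i).toNat : ℝ)| ≤ α / g := by
    intro y a j ha
    have h2 := (norm_le_pi_norm ((fun t => (countDistinct (X y) t : ℝ)) - a) (t j)).trans ha
    rw [Pi.sub_apply, Real.norm_eq_abs, hcount, hor, abs_sub_comm] at h2
    have habs : ∀ r : ℝ, |r| * g = |r * g| := fun r => by rw [abs_mul, abs_of_pos hg']
    rw [le_div_iff₀ hg', habs]
    convert h2 using 2
    simp only [b]
    field_simp
    ring
  have hc : ∀ y a, err (X y) a ≤ α → ∀ j,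
      |c a j - ∑ i, H j i * ((y i).toNat : ℝ)| ≤ 3 * (α / g) := by
    intro y a ha j
    have h2 := abs_le.1 (hb y a j ha)
    have h3 := abs_le.1 (hb y a j₀ ha)
    -- Since row `j₀` is constantly 1, `H j = 2 · (1 + H j) / 2 - (1 + H j₀) / 2`; the coefficients
    -- 2 and 1 triple the noise.
    have h4 : ∑ i, H j i * ((y i).toNat : ℝ) = 2 * ∑ i, (1 + H j i) / 2 * ((y i).toNat : ℝ) -
        ∑ i, (1 + H j₀ i) / 2 * ((y i).toNat : ℝ) := by
      rw [Finset.mul_sum, ← Finset.sum_sub_distrib]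
      refine Finset.sum_congr rfl fun i _ => ?_
      rw [h0]
      ring
    rw [h4, abs_le]
    simp only [c]
    constructor <;> linarith
  let S : Fin n → Set (Fin T → ℝ) := fun i => {a | 1 / 2 < (∑ j, H j i * c a j) / n}
  have hS : ∀ i, MeasurableSet (S i) := by
    intro i
    refine measurableSet_lt measurable_const ?_
    simp only [c, b]
    fun_prop
  have key := not_private_of_reconstruction hn
    (fun y => (M (X y) : Measure (Fin T → ℝ))) (K := Real.exp 1) (κ := Real.exp 1 / 100)
    (β := 1 / 5) (γ := 1 / 100) S hS (fun y => {a | err (X y) a ≤ α})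
    (fun y => err_measurableSet _ _) (fun y => by
      have := hα (X y) (hXflip y)
      linarith) ?_ (by norm_num) (Real.exp_pos 1).le ?_
  -- The conclusion `1 - e / 100 ≤ (1 + e) (1 / 5 + 1 / 100)` would force `e > 3.5`.
  · have := Real.exp_one_lt_d9
    linarith
  · intro y a ha
    have h2 := hadamard_decode hn H hs ho y (c a) (hc y a ha)
    have h3 : 0 ≤ α := (norm_nonneg _).trans ha
    -- With `τ = 3 α / g` this gives `4 τ² ≤ 36 n / 196 < n / 5`, which is why 14 suffices.
    have h4 : (α / g) ^ 2 ≤ 1 / 196 * (n : ℝ) := by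
      have h5 : α / g ≤ 1 / 14 * √(n : ℝ) := by
        rw [div_le_iff₀ hg']
        linarith
      calc (α / g) ^ 2 ≤ (1 / 14 * √(n : ℝ)) ^ 2 := by gcongr
        _ = 1 / 196 * (n : ℝ) := by
          rw [mul_pow, Real.sq_sqrt (Nat.cast_nonneg n)]
          norm_num
    have hn0 : (0 : ℝ) ≤ n := Nat.cast_nonneg n
    refine le_trans (le_of_eq ?_) (h2.trans (by nlinarith))
    rfl
  · -- flipping one bit changes `g` entries of the stream
    have hgroup : ∀ (y y' : Fin n → Bool) i, y i = true → y' = Function.update y i false →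
        ∀ A, MeasurableSet A →
          (M (X y) : Measure (Fin T → ℝ)).real A ≤ Real.exp 1 *
            (M (X y') : Measure (Fin T → ℝ)).real A + Real.exp 1 / 100 ∧
          (M (X y') : Measure (Fin T → ℝ)).real A ≤ Real.exp 1 *
            (M (X y) : Measure (Fin T → ℝ)).real A + Real.exp 1 / 100 := by
      intro y y' i hi hy' A hA
      obtain ⟨F, hF, hFX⟩ := queryStream_update_false (T := T) hg (v := v)
        (y := fun k => y (Fin.ofNat n k)) (y' := fun k => y' (Fin.ofNat n k)) (q := q) i.2 (by
          intro k hk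
          have : Fin.ofNat n k = i ↔ k = i := by
            rw [Fin.ext_iff, Fin.val_ofNat, Nat.mod_eq_of_lt hk]
          simp only [hy', Function.update_apply, this])
      have h2 := hM.group hε hδ (X y) hA F
      simp only [X] at h2 ⊢
      rw [hFX]
      have hF' : (F.card : ℝ) ≤ g := by exact_mod_cast hF
      have h3 : Real.exp (F.card * ε) ≤ Real.exp 1 := by
        rw [Real.exp_le_exp]
        exact (mul_le_mul_of_nonneg_right hF' hε).trans hgε
      have h4 : F.card * Real.exp (F.card * ε) * δ ≤ Real.exp 1 / 100 := by
        calc F.card * Real.exp (F.card * ε) * δ = Real.exp (F.card * ε) * (F.card * δ) := by ring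
          _ ≤ Real.exp 1 * (1 / 100) := by
            refine mul_le_mul h3 ?_ (by positivity) (by positivity)
            exact (mul_le_mul_of_nonneg_right hF' hδ).trans hgδ
          _ = _ := by ring
      constructor
      · refine h2.1.trans (add_le_add (mul_le_mul_of_nonneg_right h3 measureReal_nonneg) h4)
      · refine h2.2.trans (add_le_add (mul_le_mul_of_nonneg_right h3 measureReal_nonneg) h4)
    intro y i A hA
    cases hy : y i
    · refine (hgroup (Function.update y i true) y i (by simp) ?_ A hA).2
      rw [Function.update_idem, ← hy, Function.update_eq_self]
    · exact (hgroup y _ i hy rfl A hA).1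

/-! ### Choice of parameters and conclusion -/

/-- The numerical choice of the number of bits and of the number of copies of each bit. -/
theorem exists_parameters {T w : ℕ} {ε : ℝ} (hT : 3 ≤ T) (hw : 3 ≤ w) (hε : 0 < ε) (hε1 : ε ≤ 1) :
    ∃ m g : ℕ, 0 < g ∧ 2 ^ m * g * (2 * 2 ^ m + 1) ≤ T ∧ 2 * 2 ^ m + 1 ≤ w ∧ g * ε ≤ 1 ∧
      1 / 6 * min (min (√(w : ℝ) / ε) ((T : ℝ) ^ (1 / 4 : ℝ) / ε ^ (3 / 4 : ℝ))) (T : ℝ) ≤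
        g * √((2 : ℝ) ^ m) := by
  have hTpos : (0 : ℝ) < T := by exact_mod_cast (by omega : 0 < T)
  -- Here `g` is the minimum of `⌊1 / ε⌋` and `T / 3`; the bound `3 * g ≤ T` makes `n = 1`
  -- admissible.
  obtain ⟨g, hg, hg3, hgε, hgl⟩ : ∃ g : ℕ, 0 < g ∧ 3 * g ≤ T ∧ g * ε ≤ 1 ∧
      (1 / 2 ≤ g * ε ∨ (T : ℝ) ≤ 6 * g) := by
    have hfl : (1 : ℕ) ≤ ⌊1 / ε⌋₊ := Nat.le_floor (by
      rw [Nat.cast_one, le_div_iff₀ hε]; linarith)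
    have hfε : (⌊1 / ε⌋₊ : ℝ) * ε ≤ 1 := by
      rw [← le_div_iff₀ hε]
      exact Nat.floor_le (by positivity)
    rcases le_total ⌊1 / ε⌋₊ (T / 3) with h | h
    · refine ⟨⌊1 / ε⌋₊, hfl, by omega, hfε, Or.inl ?_⟩
      have h1 := Nat.lt_floor_add_one (1 / ε)
      rw [div_lt_iff₀ hε] at h1
      have h2 : (1 : ℝ) ≤ ⌊1 / ε⌋₊ := by exact_mod_cast hfl
      nlinarith
    · refine ⟨T / 3, by omega, by omega, ?_, Or.inr ?_⟩
      · refine le_trans (mul_le_mul_of_nonneg_right ?_ hε.le) hfε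
        exact_mod_cast h
      · exact_mod_cast (by omega : T ≤ 6 * (T / 3))
  have hg' : (0 : ℝ) < g := by exact_mod_cast hg
  let p : ℕ → Prop := fun m => 2 ^ m * g * (2 * 2 ^ m + 1) ≤ T ∧ 2 * 2 ^ m + 1 ≤ w
  have hp0 : p 0 := ⟨by simp; omega, by simpa using hw⟩
  -- An exponent at which doubling `n = 2 ^ m` breaks a constraint; one exists because `2 ^ w > w`.
  obtain ⟨m, hm, hm'⟩ : ∃ m, p m ∧ ¬ p (m + 1) := by
    by_contra! hcon
    have hall : ∀ m, p m := fun m => Nat.rec hp0 hcon m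
    have := (hall w).2
    have := Nat.lt_two_pow_self (n := w)
    omega
  refine ⟨m, g, hg, hm.1, hm.2, hgε, ?_⟩
  have hN1 : (1 : ℝ) ≤ (2 : ℝ) ^ m := one_le_pow₀ (by norm_num)
  have hsN1 : 1 ≤ √((2 : ℝ) ^ m) := Real.one_le_sqrt.2 hN1
  rcases hgl with hgl | hgl
  -- Whichever constraint fails for `2 n` bounds `w` or `T` from above in terms of `n`. The slack
  -- constant 9 is a perfect square, convenient for the square root.
  · have hcases : (w : ℝ) ≤ 9 * 2 ^ m ∨ (T : ℝ) ≤ 10 * (2 ^ m) ^ 2 * g := by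
      have hpos : 1 ≤ 2 ^ m := Nat.one_le_two_pow
      rcases not_and_or.1 hm' with h | h
      · right
        have : T ≤ 10 * (2 ^ m) ^ 2 * g := by
          have h2 := (not_le.1 h).le
          rw [pow_succ] at h2
          nlinarith [Nat.mul_le_mul_left (2 ^ m * g * 2) hpos]
        exact_mod_cast this
      · left
        have : w ≤ 9 * 2 ^ m := by
          rw [pow_succ] at h
          omega
        exact_mod_cast this
    rcases hcases with h | h
    · refine le_trans (mul_le_mul_of_nonneg_left ((min_le_left _ _).trans (min_le_left _ _))
        (by norm_num)) ?_
      have h2 : √(w : ℝ) ≤ 3 * √((2 : ℝ) ^ m) := by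
        rw [Real.sqrt_le_left (by positivity), mul_pow, Real.sq_sqrt (by positivity)]
        linarith
      rw [mul_div_assoc', div_le_iff₀ hε]
      nlinarith
    · refine le_trans (mul_le_mul_of_nonneg_left ((min_le_left _ _).trans (min_le_right _ _))
        (by norm_num)) ?_
      have hT4 : ((T : ℝ) ^ (1 / 4 : ℝ)) ^ 4 = T := by
        rw [← Real.rpow_natCast, ← Real.rpow_mul hTpos.le]
        norm_num
      have hε4 : (ε ^ (3 / 4 : ℝ)) ^ 4 = ε ^ 3 := by
        rw [← Real.rpow_natCast, ← Real.rpow_mul hε.le]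
        norm_num
      -- Fourth powers clear the fractional exponents; what remains is `10 / 6 ^ 4 ≤ 1 / 8 ≤ (g ε) ^
      -- 3`.
      refine le_of_pow_le_pow_left₀ (n := 4) (by norm_num) (by positivity) ?_
      rw [mul_pow (1 / 6 : ℝ), div_pow ((T : ℝ) ^ (1 / 4 : ℝ)), hT4, hε4, mul_pow,
        show √((2 : ℝ) ^ m) ^ 4 = (√((2 : ℝ) ^ m) ^ 2) ^ 2 by ring, Real.sq_sqrt (by positivity),
        mul_div_assoc', div_le_iff₀ (by positivity)]
      have h3 : (1 / 2 : ℝ) ^ 3 ≤ (g * ε) ^ 3 := by gcongr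
      calc (1 / 6 : ℝ) ^ 4 * T ≤ (1 / 6 : ℝ) ^ 4 * (10 * (2 ^ m) ^ 2 * g) := by gcongr
        _ ≤ (1 / 2 : ℝ) ^ 3 * ((2 ^ m) ^ 2 * g) := by
          have : (0 : ℝ) ≤ (2 ^ m) ^ 2 * g := by positivity
          linarith
        _ ≤ (g * ε) ^ 3 * ((2 ^ m) ^ 2 * g) := by gcongr
        _ = _ := by ring
  · refine le_trans (mul_le_mul_of_nonneg_left (min_le_right _ _) (by norm_num)) ?_
    nlinarith

end TurnstileDP

theorem theorem1p6 :
    ∃ c : ℝ, 0 < c ∧ ∃ η : ℝ, 0 < η ∧ ∃ N : ℕ,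
      ∀ (U : Type*) (T : ℕ) (ε δ α : ℝ) (M : TurnstileDP.Mechanism U T),
        N ≤ T → (T : ℕ∞) ≤ ENat.card U →
        0 < ε → ε ≤ 1 → 0 ≤ δ → δ ≤ η * (ε / (T : ℝ)) →
        TurnstileDP.EventLevelDP M ε δ →
        (∀ w : ℕ, N ≤ w → w ≤ T →
          TurnstileDP.AccurateOn M α {x | TurnstileDP.maxFlippancy x ≤ w} →
          c * min (min (√(w : ℝ) / ε) ((T : ℝ) ^ (1 / 4 : ℝ) / ε ^ (3 / 4 : ℝ))) (T : ℝ) ≤ α) ∧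
        (TurnstileDP.AccurateOn M α Set.univ → c * (T : ℝ) ^ (1 / 4 : ℝ) ≤ α) := by
  refine ⟨1 / 84, by norm_num, 1 / 100, by norm_num, 3, ?_⟩
  intro U T ε δ α M hT hU hε hε1 hδ hδ1 hM
  have hT1 : (1 : ℝ) ≤ T := by exact_mod_cast (by omega : 1 ≤ T)
  have main : ∀ w : ℕ, 3 ≤ w → w ≤ T →
      TurnstileDP.AccurateOn M α {x | TurnstileDP.maxFlippancy x ≤ w} →
      1 / 84 * min (min (√(w : ℝ) / ε) ((T : ℝ) ^ (1 / 4 : ℝ) / ε ^ (3 / 4 : ℝ))) (T : ℝ) ≤ α := by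
    intro w hw _ hα
    obtain ⟨m, g, hg, hgT, hmw, hgε, hle⟩ := TurnstileDP.exists_parameters hT hw hε hε1
    have hgδ : g * δ ≤ 1 / 100 := by
      -- Only `δ ≤ ε / 100` is needed, because `g ε ≤ 1`.
      have h1 : δ ≤ 1 / 100 * ε := hδ1.trans (by gcongr; exact div_le_self hε.le hT1)
      calc g * δ ≤ g * (1 / 100 * ε) := by gcongr
        _ = 1 / 100 * (g * ε) := by ring
        _ ≤ 1 / 100 := by linarith
    obtain ⟨H, h1, hs, ⟨j₀, h0⟩, ho⟩ := TurnstileDP.exists_symm_hadamard m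
    have := TurnstileDP.mul_sqrt_le_of_accurateOn (by positivity) H h1 hs h0
      (by simpa using ho) hg hgT hU hε.le hgε hδ hgδ hM
      (fun x hx => hα x (le_trans hx hmw))
    push_cast at this
    linarith
  refine ⟨main, fun hα => ?_⟩
  -- With `w = T` and `ε ≤ 1`, each of the three terms is at least `T ^ (1 / 4)`.
  refine le_trans ?_ (main T hT le_rfl fun x _ => hα x trivial)
  refine mul_le_mul_of_nonneg_left (le_min (le_min ?_ ?_) ?_) (by norm_num)
  · rw [Real.sqrt_eq_rpow]
    refine le_trans (Real.rpow_le_rpow_of_exponent_le hT1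
      (by norm_num : (1 / 4 : ℝ) ≤ 1 / 2)) ?_
    exact le_div_self (by positivity) hε hε1
  · exact le_div_self (by positivity) (by positivity) (Real.rpow_le_one hε.le hε1 (by norm_num))
  · calc (T : ℝ) ^ (1 / 4 : ℝ) ≤ (T : ℝ) ^ (1 : ℝ) :=
          Real.rpow_le_rpow_of_exponent_le hT1 (by norm_num)
      _ = T := Real.rpow_one _
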